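/- Consider a distributed storage system with $n$ noncolluding nodes that stores $f\ge 1$ files $X^{(1)},\dots,X^{(f)}$, each a $\beta\times k$ matrix over a finite field $\mathbb{F}_q$ (independent and uniformly distributed); every row of every file is encoded with an $[n,k]$ code $\mathcal{C}$ over $\mathbb{F}_q$ with a given generator matrix, and node $l$ stores the $l$-th symbols of the codewords. To retrieve file $m$, the user, who does not know the files, sends random queries $Q_l$ to the nodes $l=1,\dots,n$, and node $l$ returns $d_l$ symbols $A_l\in\mathbb{F}_q^{d_l}$, a deterministic function of $Q_l$ and its content. The protocol is a perfect PIR protocol if $I(m;Q_l,A_l,X^{(1)},\dots,X^{(f)})=0$ for every $l$ and every distribution of $m$, and $H(X^{(m)}\mid A_1,\dots,A_n,Q_1,\dots,Q_n)=0$ for every $m$. Its rate is $\beta k/\sum_l d_l$. A rate is achievable for $f$ files if some perfect PIR protocol (with some number $\beta\ge 1$ of stripes) has that rate; it is achievable by a file-independent protocol if this holds for all $f\ge 1$ with $\beta$ and $d_1,\dots,d_n$ independent of $f$. For an $[n',k']$ code with generator matrix $G'$, call a $k'$-set $I$ of coordinates an information set if the columns of $G'$ indexed by $I$ form an invertible matrix.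 The code is called MDS-PIR capacity-achieving if, for some $\nu\ge 1$ and $\kappa$ with $\kappa/\nu=k'/n'$, there is a binary $\nu\times n'$ matrix all of whose columns have Hamming weight $\kappa$ and the support of each of whose rows contains an information set. Let $$C_f^{[n',k']}=\frac{n'-k'}{n'}\Bigl[1-\Bigl(\frac{k'}{n'}\Bigr)^f\Bigr]^{-1}\quad(k'<n'),\qquad C_f^{[n',n']}=\frac1f,\qquad C_\infty^{[n',k']}=\frac{n'-k'}{n'} .$$ Theorem. Suppose that $\mathcal{C}$ is isometric (under a linear Hamming isometry of the ambient spaces) to the direct sum of $P\ge1$ MDS-PIR capacity-achieving $[n_p,k_p]$ codes with $k_p\ge1$, i.e. to the code generated by the block diagonal matrix with blocks $G_1,\dots,G_P$, where $G_p$ is a generator matrix of the $p$-th code. Then for every $f\ge 1$ the PIR rate $$R_{f,\mathsf{B}}(\mathcal{C})=\Bigl(\sum_{p=1}^P\frac{k_p}{k}\bigl(C_f^{[n_p,k_p]}\bigr)^{-1}\Bigr)^{-1}$$ is achievable for $f$ files. Moreover, if $k_p<n_p$ for all $p$, then $$R_{\infty,\mathsf{B}}(\mathcal{C})=\lim_{f\to\infty}R_{f,\mathsf{B}}(\mathcal{C})=\Bigl(\sum_{p=1}^P\frac{k_p}{k}\bigl(C_\infty^{[n_p,k_p]}\bigr)^{-1}\Bigr)^{-1},$$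 and this rate is achievable by a file-independent PIR protocol. -/

import Mathlib

open Filter Topology

universe u

/-! ### Linear codes -/

/-- The linear code generated by the rows of a matrix. -/
def rowCode {F : Type u} [Field F] {r c : Type*} (G : Matrix r c F) : Submodule F (c → F) :=
  Submodule.span F (Set.range G.row)

/-- `G` generates a code whose dimension is its number of rows: the rows are linearly independent. -/
def IsGeneratorMatrix {F : Type u} [Field F] {r c : Type*} (G : Matrix r c F) : Prop :=
  LinearIndependent F G.row

/-- Two linear codes are isometric if a linear Hamming isometry of the ambient spaces maps one onto
the other. -/
def AreIsometric {F : Type u} [Field F] [DecidableEq F] {a b : Type*} [Fintype a] [Fintype b]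
    (C : Submodule F (a → F)) (C' : Submodule F (b → F)) : Prop :=
  ∃ φ : (a → F) ≃ₗ[F] (b → F),
    (∀ x y, hammingDist (φ x) (φ y) = hammingDist x y) ∧ C.map φ.toLinearMap = C'

/-- A set of `k` coordinates on which the `k × n` generator matrix `G` is invertible. -/
def IsInformationSet {F : Type u} [Field F] {n k : ℕ} (G : Matrix (Fin k) (Fin n) F)
    (I : Finset (Fin n)) : Prop :=
  ∃ h : I.card = k, IsUnit (G.submatrix id (I.orderEmbOfFin h))

/-- A binary `ν × n` matrix all of whose columns have Hamming weight `κ` and the support of each of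
whose rows contains an information set of the code generated by `G`. -/
def IsPIRAchievableRateMatrix {F : Type u} [Field F] {n k ν : ℕ} (G : Matrix (Fin k) (Fin n) F)
    (κ : ℕ) (Λ : Matrix (Fin ν) (Fin n) Bool) : Prop :=
  (∀ j, (Finset.univ.filter fun i => Λ i j = true).card = κ) ∧
    ∀ i, ∃ I : Finset (Fin n), IsInformationSet G I ∧ ∀ j ∈ I, Λ i j = true

/-- The `[n, k]` code generated by `G` has a PIR achievable rate matrix with `κ / ν = k / n`. -/
def IsMDSPIRCapacityAchieving {F : Type u} [Field F] {n k : ℕ} (G : Matrix (Fin k) (Fin n) F) :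
    Prop :=
  ∃ κ ν : ℕ, 0 < ν ∧ (κ : ℚ) / ν = (k : ℚ) / n ∧
    ∃ Λ : Matrix (Fin ν) (Fin n) Bool, IsPIRAchievableRateMatrix G κ Λ

/-! ### Entropy of finite random variables (in nats) -/

/-- Shannon entropy. -/
noncomputable def entropy {A : Type*} [Fintype A] (p : PMF A) : ℝ :=
  ∑ a, Real.negMulLog (p a).toReal

/-- `H(X | Y)` for a pair `(X, Y)` with law `p`. -/
noncomputable def condEntropy {A B : Type*} [Fintype A] [Fintype B] (p : PMF (A × B)) : ℝ :=
  entropy p - entropy (p.map Prod.snd)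

/-- `I(X ; Y)` for a pair `(X, Y)` with law `p`. -/
noncomputable def mutualInfo {A B : Type*} [Fintype A] [Fintype B] (p : PMF (A × B)) : ℝ :=
  entropy (p.map Prod.fst) + entropy (p.map Prod.snd) - entropy p

/-! ### Private information retrieval from coded storage -/

/-- `f` files, each a `β × k` matrix over `F`. -/
abbrev Files (F : Type u) (f β k : ℕ) : Type u := Fin f → Matrix (Fin β) (Fin k) F

/-- The code symbols stored on node `l`: entry `(m, i)` is the `l`-th symbol of the codeword that
encodes the `i`-th row of the `m`-th file. -/
def nodeContent {F : Type u} [Field F] {n k f β : ℕ} (G : Matrix (Fin k) (Fin n) F)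
    (X : Files F f β k) (l : Fin n) : Fin f → Fin β → F :=
  fun m i => (X m * G) i l

/-- A protocol for `n` nodes that store `f` files with `β` stripes, in which node `l` returns
`d l` symbols. The joint law of the queries depends on the index of the wanted file only (the user
does not know the files); a response is a function of the query and the content of the node. -/
structure PIRProtocol (F : Type u) (n f β : ℕ) (d : Fin n → ℕ) where
  Query : Fin n → Type u
  queryFintype : ∀ l, Fintype (Query l)
  queryLaw : Fin f → PMF (∀ l, Query l)
  answer : ∀ l, Query l → (Fin f → Fin β → F) → (Fin (d l) → F)

attribute [instance] PIRProtocol.queryFintype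

namespace PIRProtocol

variable {F : Type u} [Field F] [Fintype F] {n k f β : ℕ} {d : Fin n → ℕ}

/-- Joint law of the queries for file `m` and the files; the files are uniformly distributed and
independent of the queries. -/
noncomputable def jointLaw (S : PIRProtocol F n f β d) (k : ℕ) (m : Fin f) :
    PMF ((∀ l, S.Query l) × Files F f β k) :=
  (S.queryLaw m).bind fun q =>
    (PMF.uniformOfFintype (Files F f β k)).map fun X => (q, X)

/-- The response of node `l`. -/
def response (S : PIRProtocol F n f β d) (G : Matrix (Fin k) (Fin n) F)
    (q : ∀ l, S.Query l) (X : Files F f β k) (l : Fin n) : Fin (d l) → F :=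
  S.answer l (q l) (nodeContent G X l)

open scoped Classical in
/-- Privacy: `I(m ; Q_l, A_l, X⁽¹⁾, …, X⁽ᶠ⁾) = 0` at every node `l`, whatever the distribution `μ`
of the index `m` of the wanted file. -/
def IsPrivate (S : PIRProtocol F n f β d) (G : Matrix (Fin k) (Fin n) F) : Prop :=
  ∀ (μ : PMF (Fin f)) (l : Fin n),
    mutualInfo (μ.bind fun m => (S.jointLaw k m).map fun ω =>
      (m, (ω.1 l, S.response G ω.1 ω.2 l, ω.2))) = 0

open scoped Classical in
/-- Recovery: `H(X⁽ᵐ⁾ | A_1, …, A_n, Q_1, …, Q_n) = 0` for every wanted file `m`. -/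
def Recovers (S : PIRProtocol F n f β d) (G : Matrix (Fin k) (Fin n) F) : Prop :=
  ∀ m : Fin f,
    condEntropy ((S.jointLaw k m).map fun ω =>
      (ω.2 m, (fun l => S.response G ω.1 ω.2 l, ω.1))) = 0

/-- Perfect information-theoretic PIR. -/
def IsPerfect (S : PIRProtocol F n f β d) (G : Matrix (Fin k) (Fin n) F) : Prop :=
  S.IsPrivate G ∧ S.Recovers G

end PIRProtocol

/-- The PIR rate `β k / D`, where `D` is the total number of downloaded symbols. -/
noncomputable def pirRate {n : ℕ} (k β : ℕ) (d : Fin n → ℕ) : ℝ :=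
  ((β * k : ℕ) : ℝ) / ((∑ l, d l : ℕ) : ℝ)

/-- Some perfect PIR protocol for `f` files encoded with `G` has rate `R`. -/
def IsAchievableRate {F : Type u} [Field F] [Fintype F] {n k : ℕ} (G : Matrix (Fin k) (Fin n) F)
    (f : ℕ) (R : ℝ) : Prop :=
  ∃ (β : ℕ) (d : Fin n → ℕ), 0 < β ∧ pirRate k β d = R ∧
    ∃ S : PIRProtocol F n f β d, S.IsPerfect G

/-- The rate `R` is achieved by a file-independent protocol: the number of stripes (the file size)
and the number of symbols downloaded from each node do not depend on the number `f` of files. -/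
def IsFileIndependentAchievableRate {F : Type u} [Field F] [Fintype F] {n k : ℕ}
    (G : Matrix (Fin k) (Fin n) F) (R : ℝ) : Prop :=
  ∃ (β : ℕ) (d : Fin n → ℕ), 0 < β ∧ pirRate k β d = R ∧
    ∀ f : ℕ, 0 < f → ∃ S : PIRProtocol F n f β d, S.IsPerfect G

/-! ### Rates -/

/-- The MDS-PIR capacity for `f` files; for `k = n`, where the closed form reads `0 / 0`, its
continuous extension `1 / f`. -/
noncomputable def mdsPIRCapacity (n k f : ℕ) : ℝ :=
  if k = n then 1 / (f : ℝ)
  else ((n : ℝ) - k) / n * (1 - ((k : ℝ) / n) ^ f)⁻¹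

/-- The asymptotic MDS-PIR capacity. -/
noncomputable def mdsPIRCapacityInf (n k : ℕ) : ℝ := ((n : ℝ) - k) / n

/-- The rate for a code of dimension `k` and `f` files, from components `[n_p, k_p]`. -/
noncomputable def directSumRate (k : ℕ) {P : ℕ} (np kp : Fin P → ℕ) (f : ℕ) : ℝ :=
  (∑ p, (kp p : ℝ) / k * (mdsPIRCapacity (np p) (kp p) f)⁻¹)⁻¹

/-- The asymptotic rate for a code of dimension `k`, from components `[n_p, k_p]`. -/
noncomputable def directSumRateInf (k : ℕ) {P : ℕ} (np kp : Fin P → ℕ) : ℝ :=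
  (∑ p, (kp p : ℝ) / k * (mdsPIRCapacityInf (np p) (kp p))⁻¹)⁻¹

/-! ### Finite random variables -/

/-! Entropy is removed first. A `RetrievalScheme` recovers deterministically, for each key, and is
private because at each node a bijection of the keys turns the queries for one file into those for
another; `toProtocol_isPerfect` translates this into the two entropy conditions.

For a single code, the rate matrix becomes a family of permutations `θ l` of `ν` labels, `κ` of them
dummies, such that for every label `i` the nodes with `θ l i` dummy contain an information set
(`exists_labelling`). This property is used twice: nodes that add no wanted symbol at a given place
reveal the interference of the other files there, and, the interference being subtracted, every
wanted stripe is then seen at an information set. In `sumScheme` the interference is a sum of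
randomly placed stripes, which gives the capacity for `f` files; in `starScheme` it is a random
linear combination of all stripes, which gives the asymptotic capacity with sizes independent of
`f`. For `k = n` everything is downloaded.

A linear Hamming isometry is monomial, so the nodes can rescale their symbols and act as the nodes
of the direct sum (`ofMonomial`). The components are brought to a common number of stripes
(`copies`) and run side by side (`directSum`). Downloads add up, hence inverse rates are averaged
with weights `k_p / k` (`exists_protocol_of_components`). -/

theorem PMF.map_equiv_uniformOfFintype {A : Type*} [Fintype A] [Nonempty A] (e : A ≃ A) :
    (PMF.uniformOfFintype A).map e = PMF.uniformOfFintype A := by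
  classical
  ext b
  rw [PMF.map_apply, tsum_eq_single (e.symm b)]
  · simp
  · intro a ha
    rw [if_neg]
    rintro rfl
    simp at ha

theorem PMF.sum_toReal {A : Type*} [Fintype A] (p : PMF A) : ∑ a, (p a).toReal = 1 := by
  have h := p.tsum_coe
  rw [tsum_fintype] at h
  rw [← ENNReal.toReal_sum fun a _ => p.apply_ne_top a, h, ENNReal.toReal_one]

theorem PMF.bind_map_mk_apply {A B : Type*} (p : PMF A) (r : PMF B) (a : A) (b : B) :
    (p.bind fun a => r.map fun b => (a, b)) (a, b) = p a * r b := by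
  classical
  rw [PMF.bind_apply, tsum_eq_single a]
  · rw [PMF.map_apply, tsum_eq_single b]
    · simp
    · intro b' hb'
      rw [if_neg]
      simpa using hb'.symm
  · intro a' ha'
    rw [PMF.map_apply]
    simp [ha'.symm]

/-- Independent random variables have mutual information zero. -/
theorem mutualInfo_bind_map_mk {A B : Type*} [Fintype A] [Fintype B] (p : PMF A) (r : PMF B) :
    mutualInfo (p.bind fun a => r.map fun b => (a, b)) = 0 := by
  have h1 : (p.bind fun a => r.map fun b => (a, b)).map Prod.fst = p := by
    rw [PMF.map_bind]
    simp_rw [PMF.map_comp]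
    exact (congrArg p.bind (funext fun a => PMF.map_const r a)).trans p.bind_pure
  have h2 : (p.bind fun a => r.map fun b => (a, b)).map Prod.snd = r := by
    rw [PMF.map_bind]
    simp_rw [PMF.map_comp]
    exact (congrArg p.bind (funext fun a => PMF.map_id r)).trans (p.bind_const r)
  rw [mutualInfo, h1, h2, entropy, entropy, entropy, Fintype.sum_prod_type]
  simp_rw [PMF.bind_map_mk_apply, ENNReal.toReal_mul, Real.negMulLog_mul, Finset.sum_add_distrib,
    ← Finset.sum_mul, ← Finset.mul_sum]
  rw [← Finset.sum_mul, PMF.sum_toReal, PMF.sum_toReal]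
  ring

/-- A random variable that is determined by another one has conditional entropy zero. -/
theorem condEntropy_eq_zero_of_injOn {A B : Type*} [Fintype A] [Fintype B] (p : PMF (A × B))
    (h : Set.InjOn Prod.snd p.support) : condEntropy p = 0 := by
  classical
  rw [condEntropy, entropy, entropy, Fintype.sum_prod_type_right, sub_eq_zero]
  refine Finset.sum_congr rfl fun b _ => ?_
  have hb : p.map Prod.snd b = ∑ a, p (a, b) := by
    rw [PMF.map_apply, tsum_fintype, Fintype.sum_prod_type]
    exact Finset.sum_congr rfl fun a _ => by simp
  rw [hb]
  -- Each fibre of the second variable carries at most one atom, so the marginal has the same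
  -- nonzero probabilities as `p`.
  by_cases hz : ∃ a, p (a, b) ≠ 0
  · obtain ⟨a, ha⟩ := hz
    have h0 : ∀ a', a' ≠ a → p (a', b) = 0 := fun a' ha' => by
      by_contra hne
      exact ha' (congrArg Prod.fst (h ((p.mem_support_iff _).2 hne) ((p.mem_support_iff _).2 ha) rfl))
    rw [Fintype.sum_eq_single a h0, Fintype.sum_eq_single a fun a' ha' => by simp [h0 a' ha']]
  · push Not at hz
    simp [hz]

/-! ### Retrieval schemes -/

/-- A retrieval scheme for files indexed by `J`, with stripes indexed by `Row`, encoded with `G`;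
node `l` returns the symbols indexed by `Slot l`. The queries are determined by the wanted file and a
uniformly distributed key. -/
structure RetrievalScheme {F : Type*} [Field F] {K N : Type*} [Fintype K] (G : Matrix K N F)
    (J Row : Type) (Slot : N → Type) where
  Key : Type u
  keyFintype : Fintype Key
  keyNonempty : Nonempty Key
  Query : N → Type u
  queryFintype : ∀ l, Fintype (Query l)
  query : J → Key → ∀ l, Query l
  answer : ∀ l, Query l → (J → Row → F) → Slot l → F
  isPrivate : ∀ l m m', ∃ τ : Equiv.Perm Key, ∀ ω, query m ω l = query m' (τ ω) l
  recovers : ∀ m ω (X X' : J → Matrix Row K F),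
    (∀ l, answer l (query m ω l) (fun j r => (X j * G) r l) =
      answer l (query m ω l) (fun j r => (X' j * G) r l)) → X m = X' m

attribute [instance] RetrievalScheme.keyFintype RetrievalScheme.keyNonempty
  RetrievalScheme.queryFintype

namespace RetrievalScheme

/-! ### From retrieval schemes to perfect protocols -/

section Protocol

universe v

variable {F : Type u} [Field F] {n k f β : ℕ} {d : Fin n → ℕ} {G : Matrix (Fin k) (Fin n) F}

/-- The protocol defined by a retrieval scheme. -/
noncomputable def toProtocol
    (S : RetrievalScheme.{v} G (Fin f) (Fin β) fun l => Fin (d l)) : PIRProtocol F n f β d where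
  -- Numbering the queries places them in the universe that `PIRProtocol` asks for, whatever the
  -- universe of the scheme.
  Query l := ULift.{u} (Fin (Fintype.card (S.Query l)))
  queryFintype _ := inferInstance
  queryLaw m := (PMF.uniformOfFintype S.Key).map fun ω l =>
    ULift.up (Fintype.equivFin _ (S.query m ω l))
  answer l q Y := S.answer l ((Fintype.equivFin _).symm q.down) Y

variable [Fintype F]

/-- A bijection preserves the uniform law of the key, so the law of the query at one node is the
same for all wanted files. The files are independent of the query and the response is a function of
both, so the whole view is independent of `m`. -/
theorem toProtocol_isPrivate (S : RetrievalScheme.{v} G (Fin f) (Fin β) fun l => Fin (d l)) :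
    S.toProtocol.IsPrivate G := by
  classical
  intro μ l
  obtain ⟨m₀, -⟩ := μ.support_nonempty
  have hq : ∀ m, (S.toProtocol.queryLaw m).map (fun q => q l) =
      (S.toProtocol.queryLaw m₀).map (fun q => q l) := by
    intro m
    obtain ⟨τ, hτ⟩ := S.isPrivate l m m₀
    simp only [toProtocol, PMF.map_comp]
    conv_rhs => rw [← PMF.map_equiv_uniformOfFintype τ, PMF.map_comp]
    congr 1
    funext ω
    simp [hτ]
  let h : S.toProtocol.Query l → Files F f β k →
      S.toProtocol.Query l × (Fin (d l) → F) × Files F f β k := fun q X =>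
    (q, S.toProtocol.answer l q (nodeContent G X l), X)
  let r : Fin f → PMF (S.toProtocol.Query l × (Fin (d l) → F) × Files F f β k) := fun m =>
    ((S.toProtocol.queryLaw m).map fun q => q l).bind fun q =>
      (PMF.uniformOfFintype (Files F f β k)).map (h q)
  have hr : ∀ m, ((S.toProtocol.jointLaw k m).map fun ω =>
      (m, (ω.1 l, S.toProtocol.response G ω.1 ω.2 l, ω.2))) = (r m₀).map fun z => (m, z) := by
    intro m
    have : r m₀ = r m := by simp only [r, hq]
    rw [this]
    simp only [r, PIRProtocol.jointLaw, PMF.map_bind, PMF.bind_map, PMF.map_comp]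
    refine congrArg _ (funext fun q => ?_)
    rw [Function.comp_apply, PMF.map_comp]
    rfl
  simp_rw [hr]
  convert mutualInfo_bind_map_mk μ (r m₀)

theorem exists_key_of_mem_support (S : RetrievalScheme.{v} G (Fin f) (Fin β) fun l => Fin (d l))
    {m : Fin f} {q : ∀ l, S.toProtocol.Query l} {X : Files F f β k}
    (h : (q, X) ∈ (S.toProtocol.jointLaw k m).support) :
    ∃ ω, q = fun l => ULift.up (Fintype.equivFin _ (S.query m ω l)) := by
  obtain ⟨q', hq', hX⟩ := (PMF.mem_support_bind_iff _ _ _).1 h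
  obtain ⟨ω, -, rfl⟩ := (PMF.mem_support_map_iff _ _ _).1 hq'
  obtain ⟨X', -, hX'⟩ := (PMF.mem_support_map_iff _ _ _).1 hX
  exact ⟨ω, (congrArg Prod.fst hX').symm⟩

theorem toProtocol_recovers (S : RetrievalScheme.{v} G (Fin f) (Fin β) fun l => Fin (d l)) :
    S.toProtocol.Recovers G := by
  classical
  intro m
  have key : ∀ p : PMF (Matrix (Fin β) (Fin k) F ×
      ((∀ l, Fin (d l) → F) × (∀ l, S.toProtocol.Query l))),
      p = ((S.toProtocol.jointLaw k m).map fun ω =>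
        (ω.2 m, (fun l => S.toProtocol.response G ω.1 ω.2 l, ω.1))) →
      Set.InjOn Prod.snd p.support := by
    rintro p rfl a ha b hb hab
    obtain ⟨⟨q, X⟩, hq, rfl⟩ := (PMF.mem_support_map_iff _ _ _).1 ha
    obtain ⟨⟨q', X'⟩, hq', rfl⟩ := (PMF.mem_support_map_iff _ _ _).1 hb
    obtain ⟨ω, rfl⟩ := S.exists_key_of_mem_support hq
    obtain ⟨ω', rfl⟩ := S.exists_key_of_mem_support hq'
    have h1 := congrArg Prod.fst hab
    have h2 := congrArg Prod.snd hab
    dsimp only at h1 h2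
    refine Prod.ext ?_ (Prod.ext h1 h2)
    refine S.recovers m ω X X' fun l => ?_
    have h3 := congrFun h1 l
    have h4 : S.query m ω' l = S.query m ω l := by
      have := congrFun h2 l
      simpa using this.symm
    simp only [PIRProtocol.response, toProtocol, Equiv.symm_apply_apply, h4] at h3
    exact h3
  convert condEntropy_eq_zero_of_injOn _ (key _ rfl)

theorem toProtocol_isPerfect (S : RetrievalScheme.{v} G (Fin f) (Fin β) fun l => Fin (d l)) :
    S.toProtocol.IsPerfect G :=
  ⟨S.toProtocol_isPrivate, S.toProtocol_recovers⟩

end Protocol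

/-! ### Operations on schemes -/

section Constructions

variable {F : Type*} [Field F] {K N : Type*} [Fintype K] {G : Matrix K N F} {J Row : Type}
  {Slot : N → Type}

/-- Relabelling the stripes and the returned symbols. -/
def reindex (S : RetrievalScheme G J Row Slot) {Row' : Type} {Slot' : N → Type} (e : Row ≃ Row')
    (s : ∀ l, Slot l ≃ Slot' l) : RetrievalScheme G J Row' Slot' where
  Key := S.Key
  keyFintype := S.keyFintype
  keyNonempty := S.keyNonempty
  Query := S.Query
  queryFintype := S.queryFintype
  query := S.query
  answer l q Y t := S.answer l q (fun j r => Y j (e r)) ((s l).symm t)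
  isPrivate := S.isPrivate
  recovers m ω X X' h := by
    have := S.recovers m ω (fun j => (X j).submatrix e id) (fun j => (X' j).submatrix e id)
      fun l => funext fun t => by
        have := congrFun (h l) (s l t)
        simpa [Matrix.mul_apply] using this
    ext r c
    simpa using congrFun (congrFun this (e.symm r)) c

/-- Several copies of a scheme, with the same queries. -/
def copies (S : RetrievalScheme G J Row Slot) (M : Type) :
    RetrievalScheme G J (M × Row) fun l => M × Slot l where
  Key := S.Key
  keyFintype := S.keyFintype
  keyNonempty := S.keyNonempty
  Query := S.Query
  queryFintype := S.queryFintype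
  query := S.query
  answer l q Y t := S.answer l q (fun j r => Y j (t.1, r)) t.2
  -- One query serves all copies: privacy concerns the query alone.
  isPrivate := S.isPrivate
  recovers m ω X X' h := by
    ext ⟨a, r⟩ c
    have := S.recovers m ω (fun j => (X j).submatrix (Prod.mk a) id)
      (fun j => (X' j).submatrix (Prod.mk a) id)
      fun l => funext fun t => by
        have := congrFun (h l) (a, t)
        simpa [Matrix.mul_apply] using this
    simpa using congrFun (congrFun this r) c

/-- The scheme for a code whose codewords arise from those of the code generated by `B` by a
permutation `σ` of the coordinates and multiplication by nonzero factors. -/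
def ofMonomial {K' N' : Type*} [Fintype K'] {B : Matrix K' N' F} {Slot : N' → Type}
    (S : RetrievalScheme B J Row Slot) (σ : N ≃ N') (c : N → F) (hc : ∀ l, c l ≠ 0)
    (A : Matrix K K' F) (hA : ∀ r l, c l * G r l = (A * B) r (σ l))
    (hinj : ∀ X X' : Matrix Row K F, X * G = X' * G → X = X') :
    RetrievalScheme G J Row fun l => Slot (σ l) where
  Key := S.Key
  keyFintype := S.keyFintype
  keyNonempty := S.keyNonempty
  Query l := S.Query (σ l)
  queryFintype l := S.queryFintype (σ l)
  query m ω l := S.query m ω (σ l)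
  answer l q Y := S.answer (σ l) q fun j r => c l * Y j r
  isPrivate l := S.isPrivate (σ l)
  recovers m ω X X' h := by
    have hXG : ∀ (X : Matrix Row K F) r l, c l * (X * G) r l = (X * A * B) r (σ l) := by
      intro X r l
      rw [Matrix.mul_assoc, Matrix.mul_apply, Matrix.mul_apply, Finset.mul_sum]
      exact Finset.sum_congr rfl fun s _ => by rw [← hA]; ring
    -- The rescaled content of node `l` is the content of node `σ l` when the files `X j * A` are
    -- encoded with `B`.
    have hXA : X m * A = X' m * A := by
      refine S.recovers m ω (fun j => X j * A) (fun j => X' j * A) fun l => ?_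
      obtain ⟨l, rfl⟩ := σ.surjective l
      have := h l
      simp only [hXG] at this
      exact this
    -- The way back from `X m * A` to `X m` leads through the stored symbols, so `A` need not be
    -- invertible.
    refine hinj _ _ (Matrix.ext fun r l => mul_left_cancel₀ (hc l) ?_)
    rw [hXG, hXG, hXA]

/-- Schemes with the same number of stripes for the components of a direct sum of codes, combined. -/
def directSum {P : Type} [Fintype P] [DecidableEq P] {K N : P → Type*} [∀ p, Fintype (K p)]
    {G : ∀ p, Matrix (K p) (N p) F} {Slot : ∀ p, N p → Type}
    (S : ∀ p, RetrievalScheme (G p) J Row (Slot p)) :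
    RetrievalScheme (Matrix.blockDiagonal' G) J Row fun l => Slot l.1 l.2 where
  Key := ∀ p, (S p).Key
  keyFintype := inferInstance
  keyNonempty := inferInstance
  Query l := (S l.1).Query l.2
  queryFintype l := (S l.1).queryFintype l.2
  query m ω l := (S l.1).query m (ω l.1) l.2
  answer l := (S l.1).answer l.2
  isPrivate l m m' := by
    obtain ⟨τ, hτ⟩ := (S l.1).isPrivate l.2 m m'
    -- The node sees only the key of its own component; the other keys stay fixed.
    refine ⟨Equiv.piCongrRight fun p => if h : l.1 = p then h ▸ τ else Equiv.refl _, fun ω => ?_⟩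
    simp [hτ]
  recovers m ω X X' h := by
    have hX : ∀ (X : Matrix Row (Σ p, K p) F) r (p : P) (l : N p),
        (X * Matrix.blockDiagonal' G) r ⟨p, l⟩ = (X.submatrix id (Sigma.mk p) * G p) r l := by
      intro X r p l
      rw [Matrix.mul_apply, Matrix.mul_apply, Fintype.sum_sigma, Fintype.sum_eq_single p]
      · simp
      · intro p' hp'
        simp [Matrix.blockDiagonal'_apply_ne _ _ _ hp']
    ext r ⟨p, c⟩
    have := (S p).recovers m (ω p) (fun j => (X j).submatrix id (Sigma.mk p))
      (fun j => (X' j).submatrix id (Sigma.mk p)) fun l => by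
        have := h ⟨p, l⟩
        simpa only [hX] using this
    simpa using congrFun (congrFun this r) c

end Constructions

end RetrievalScheme

open scoped Matrix

/-! ### The schemes for a single code -/

/-- The bijection between the two ranges extends to the finite set `B`. Hence a uniformly random
bijection composed with either injection has the same law, which is the privacy of `sumScheme`. -/
theorem Function.Injective.exists_perm_comp_eq {A B : Type*} [Finite B] {a b : A → B}
    (ha : Function.Injective a) (hb : Function.Injective b) :
    ∃ τ : Equiv.Perm B, ∀ x, a x = τ (b x) := by
  classical
  have := Fintype.ofFinite B
  refine ⟨((Equiv.ofInjective b hb).symm.trans (Equiv.ofInjective a ha)).extendSubtype,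
    fun x => ?_⟩
  rw [Equiv.extendSubtype_apply_of_mem _ _ (Set.mem_range_self x), Equiv.trans_apply,
    Equiv.ofInjective_symm_apply, Equiv.ofInjective_apply]

/-- The message is determined by its code symbols at the coordinates in `s`. -/
def DeterminesMessage {F : Type*} [Field F] {K N : Type*} [Fintype K] (G : Matrix K N F)
    (s : Set N) : Prop :=
  ∀ x y : K → F, (∀ l ∈ s, (x ᵥ* G) l = (y ᵥ* G) l) → x = y

namespace RetrievalScheme

variable {F : Type u} [Field F] {K N : Type*} [Fintype K] {G : Matrix K N F} {J T : Type}

/-- Every node returns its whole content. -/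
def full (hG : DeterminesMessage G Set.univ) : RetrievalScheme G J Unit fun _ => J where
  Key := Unit
  keyFintype := inferInstance
  keyNonempty := inferInstance
  Query _ := Unit
  queryFintype _ := inferInstance
  query _ _ _ := ()
  answer _ _ Y j := Y j ()
  isPrivate _ _ _ := ⟨Equiv.refl _, fun _ => rfl⟩
  recovers m _ _ _ h := funext fun _ => hG _ _ fun l _ => congrFun (h l) m

/-! ### The scheme for a given number of files -/

section SumScheme

variable [DecidableEq J] {dummy : T → Prop}

/-- The stripe used at a slot `(c, u)` for the file `j`, when the file `m` is wanted and the node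
relabels `T` by `σ`. -/
def sumStripe (m : J) (σ : Equiv.Perm T) (j : J)
    (s : {c // dummy c} × {u : J → T // ¬dummy (u j)}) : T × {u : J → T // ¬dummy (u j)} :=
  -- The node-dependent relabelling acts on `c` for the wanted file, but on the coordinate `u m` for
  -- the others. This makes the interference at a fixed index visible at nodes where `u m` is a
  -- dummy.
  if h : j = m then (σ.symm s.1, s.2)
  else (s.1, ⟨Function.update s.2 m (σ.symm (s.2.1 m)), by
    rw [Function.update_of_ne h]; exact s.2.2⟩)

/-- A node must never meet the same stripe of a file twice: a repetition depending on `m` would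
betray the wanted file. -/
theorem sumStripe_injective (m : J) (σ : Equiv.Perm T) (j : J) :
    Function.Injective (sumStripe (dummy := dummy) m σ j) := by
  rintro ⟨⟨c, hc⟩, u, hu⟩ ⟨⟨c', hc'⟩, u', hu'⟩ h
  unfold sumStripe at h
  split_ifs at h with hj
  · simpa using h
  · simp only [Prod.mk.injEq, Subtype.mk.injEq] at h ⊢
    refine ⟨h.1, funext fun i => ?_⟩
    have := congrFun h.2 i
    by_cases hi : i = m
    · subst hi
      simpa using this
    · simpa [Function.update_of_ne hi] using this

variable [Fintype J] [DecidablePred dummy]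

/-- The row by which the unwanted files contribute to the answers. -/
def interference {R : Type} (m : J) (ω : ∀ j, T × {u : J → T // ¬dummy (u j)} ≃ R)
    (X : J → Matrix R K F) (c : T) (u : J → T) : K → F :=
  ∑ j, if h : j ≠ m ∧ ¬dummy (u j) then X j (ω j (c, ⟨u, h.2⟩)) else 0

theorem sum_answer_eq {R : Type} (m : J) (σ : Equiv.Perm T)
    (ω : ∀ j, T × {u : J → T // ¬dummy (u j)} ≃ R) (X : J → Matrix R K F)
    (c : {c // dummy c}) (u : J → T) (l : N) :
    (∑ j, if h : ¬dummy (u j) then (X j * G) (ω j (sumStripe m σ j (c, ⟨u, h⟩))) l else 0) =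
      (interference m ω X c (Function.update u m (σ.symm (u m))) ᵥ* G) l +
      if h : ¬dummy (u m) then (X m (ω m (σ.symm c, ⟨u, h⟩)) ᵥ* G) l else 0 := by
  -- The wanted term is spread over a sum supported at `j = m`, so that both sides agree term by
  -- term.
  have hz : ∀ z : F, z = ∑ j, if j = m then z else 0 := fun z => by simp
  rw [interference, Matrix.sum_vecMul, Finset.sum_apply]
  conv_rhs => rw [hz (dite _ _ _), ← Finset.sum_add_distrib]
  refine Finset.sum_congr rfl fun j _ => ?_
  by_cases hj : j = m
  · subst hj
    by_cases h : dummy (u j)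
    · simp [h]
    · simp [h, sumStripe, Matrix.mul_apply_eq_vecMul]
  · by_cases h : dummy (u j)
    · simp [h, hj]
    · simp [h, hj, sumStripe, Matrix.mul_apply_eq_vecMul]

variable [Fintype T]

/-- The scheme for a given set `J` of files. Node `l` returns one symbol for each pair `(c, u)` of a
dummy label `c` and a tuple `u` that does not consist of dummy labels, the sum of the symbols of a
stripe from each file `j` for which `u j` is no dummy; which stripes these are is random. -/
noncomputable def sumScheme (θ : N → Equiv.Perm T)
    (hG : ∀ i, DeterminesMessage G {l | dummy (θ l i)}) {R : Type} [Fintype R]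
    (hR : ∀ j : J, Nonempty (T × {u : J → T // ¬dummy (u j)} ≃ R)) :
    RetrievalScheme.{0} G J R fun _ => {s : {c // dummy c} × (J → T) // ∃ j, ¬dummy (s.2 j)} where
  Key := ∀ j, T × {u : J → T // ¬dummy (u j)} ≃ R
  keyFintype := by classical exact inferInstance
  keyNonempty := ⟨fun j => (hR j).some⟩
  Query _ := ∀ j, {c // dummy c} × {u : J → T // ¬dummy (u j)} → R
  queryFintype _ := by classical exact inferInstance
  query m ω l j s := ω j (sumStripe m (θ l) j s)
  answer _ q Y s := ∑ j, if h : ¬dummy (s.1.2 j) then Y j (q j (s.1.1, ⟨s.1.2, h⟩)) else 0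
  isPrivate l m m' := by
    classical
    choose τ hτ using fun j => (sumStripe_injective (dummy := dummy) m (θ l) j).exists_perm_comp_eq
      (sumStripe_injective m' (θ l) j)
    refine ⟨Equiv.piCongrRight fun j => Equiv.equivCongr (τ j).symm (Equiv.refl R), fun ω => ?_⟩
    funext j s
    simp [hτ]
  recovers m ω X X' h := by
    have h' : ∀ (l : N) (c : {c // dummy c}) (u : J → T), (∃ j, ¬dummy (u j)) →
        (interference m ω X c (Function.update u m ((θ l).symm (u m))) ᵥ* G) l +
          (if h : ¬dummy (u m) then (X m (ω m ((θ l).symm c, ⟨u, h⟩)) ᵥ* G) l else 0) =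
        (interference m ω X' c (Function.update u m ((θ l).symm (u m))) ᵥ* G) l +
          (if h : ¬dummy (u m) then (X' m (ω m ((θ l).symm c, ⟨u, h⟩)) ᵥ* G) l else 0) := by
      intro l c u hu
      have := congrFun (h l) ⟨(c, u), hu⟩
      rwa [sum_answer_eq, sum_answer_eq] at this
    have hI : ∀ (c : {c // dummy c}) (u : J → T),
        interference m ω X c u = interference m ω X' c u := by
      intro c u
      by_cases hu : ∃ j, j ≠ m ∧ ¬dummy (u j)
      · obtain ⟨j, hj, hju⟩ := hu
        refine hG (u m) _ _ fun l hl => ?_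
        have hl : dummy (θ l (u m)) := hl
        -- At this slot the coordinate `m` is a dummy, so no wanted symbol is added, and undoing `θ
        -- l` gives the interference at `u` itself.
        have := h' l c (Function.update u m (θ l (u m)))
          ⟨j, by rwa [Function.update_of_ne hj]⟩
        simpa [hl] using this
      -- No slot need exist here, as making `u m` a dummy may leave dummies only; but the
      -- interference is an empty sum.
      · have h0 : ∀ j, ¬(j ≠ m ∧ ¬dummy (u j)) := fun j hj => hu ⟨j, hj⟩
        simp only [interference, h0, dite_false]
    funext r
    obtain ⟨⟨i, u, hu⟩, rfl⟩ := (ω m).surjective r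
    refine hG i _ _ fun l hl => ?_
    -- The dummy `θ l i` is chosen because `(θ l).symm` takes it back to `i`: all these nodes hold a
    -- symbol of the same wanted stripe.
    have := h' l ⟨θ l i, hl⟩ u ⟨m, hu⟩
    rw [hI] at this
    simpa [hu] using this

end SumScheme

/-! ### The file-independent scheme -/

section StarScheme

variable [Fintype F] [Fintype J] [DecidableEq J] [Fintype T] [DecidableEq T] {dummy : T → Prop}
  [DecidablePred dummy]

/-- The scheme whose number of stripes and of returned symbols does not depend on the number of
files. Each query vector is a random vector that is common to all nodes, to which some of the nodes
add a unit vector that belongs to the wanted file. -/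
def starScheme (θ : N → Equiv.Perm T) (hG : ∀ i, DeterminesMessage G {l | dummy (θ l i)}) :
    RetrievalScheme.{u} G J ({b // ¬dummy b} × T) fun _ => {c // dummy c} × T where
  Key := {c // dummy c} × T → J × ({b // ¬dummy b} × T) → F
  keyFintype := inferInstance
  keyNonempty := inferInstance
  Query _ := {c // dummy c} × T → J × ({b // ¬dummy b} × T) → F
  queryFintype _ := inferInstance
  query m y l s := y s +
    if h : dummy (θ l s.2) then 0 else Pi.single (m, (⟨θ l s.2, h⟩, (θ l).symm s.1)) 1
  answer _ q Y s := ∑ z : J × ({b // ¬dummy b} × T), q s z * Y z.1 z.2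
  isPrivate l m m' := by
    -- The uniform vectors `y` act as a one-time pad; the difference of the two unit vectors is
    -- absorbed by a translation.
    refine ⟨Equiv.addRight fun s =>
      (if h : dummy (θ l s.2) then 0 else Pi.single (m, (⟨θ l s.2, h⟩, (θ l).symm s.1)) 1) -
      (if h : dummy (θ l s.2) then 0 else Pi.single (m', (⟨θ l s.2, h⟩, (θ l).symm s.1)) 1),
      fun y => ?_⟩
    funext s
    simp [add_assoc]
  recovers m y X X' h := by
    let I : (J → Matrix ({b // ¬dummy b} × T) K F) → {c // dummy c} × T → K → F := fun X s =>
      ∑ z, y s z • X z.1 z.2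
    have hans : ∀ (X : J → Matrix ({b // ¬dummy b} × T) K F) (l : N) (s : {c // dummy c} × T),
        (∑ z : J × ({b // ¬dummy b} × T), (y s + if h : dummy (θ l s.2) then 0 else
          Pi.single (m, (⟨θ l s.2, h⟩, (θ l).symm s.1)) 1 : J × ({b // ¬dummy b} × T) → F) z *
            (X z.1 * G) z.2 l) =
        (I X s ᵥ* G) l + if h : dummy (θ l s.2) then 0 else
          (X m (⟨θ l s.2, h⟩, (θ l).symm s.1) ᵥ* G) l := by
      intro X l s
      simp only [Pi.add_apply, add_mul, Finset.sum_add_distrib]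
      congr 1
      · simp only [I, Matrix.sum_vecMul, Finset.sum_apply, Matrix.smul_vecMul, Pi.smul_apply,
          smul_eq_mul, Matrix.mul_apply_eq_vecMul]
      · by_cases h : dummy (θ l s.2)
        · simp [h]
        · simp only [h, dite_false]
          rw [Fintype.sum_eq_single (m, (⟨θ l s.2, h⟩, (θ l).symm s.1))]
          · rw [Pi.single_eq_same, one_mul, Matrix.mul_apply_eq_vecMul]
          · intro z hz
            rw [Pi.single_eq_of_ne hz, zero_mul]
    have h' : ∀ (l : N) (s : {c // dummy c} × T),
        (I X s ᵥ* G) l + (if h : dummy (θ l s.2) then 0 else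
          (X m (⟨θ l s.2, h⟩, (θ l).symm s.1) ᵥ* G) l) =
        (I X' s ᵥ* G) l + (if h : dummy (θ l s.2) then 0 else
          (X' m (⟨θ l s.2, h⟩, (θ l).symm s.1) ᵥ* G) l) := by
      intro l s
      rw [← hans, ← hans]
      exact congrFun (h l) s
    -- Nodes for which `θ l s.2` is a dummy add no unit vector and return pure interference.
    have hI : ∀ s, I X s = I X' s := fun s => hG s.2 _ _ fun l hl => by
      have hl : dummy (θ l s.2) := hl
      simpa [hl] using h' l s
    funext ⟨⟨b, hb⟩, i⟩
    refine hG i _ _ fun l hl => ?_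
    -- The second label is sent by `θ l` to `b`, which is no dummy, so the unit vector is present
    -- and points to the stripe `(b, i)`.
    have := h' l (⟨θ l i, hl⟩, (θ l).symm b)
    rw [hI] at this
    simpa [hb] using this

end StarScheme

end RetrievalScheme

/-! ### Linear codes -/

section Codes

variable {F : Type u} [Field F]

theorem DeterminesMessage.mono {K N : Type*} [Fintype K] {G : Matrix K N F} {s t : Set N}
    (hs : DeterminesMessage G s) (hst : s ⊆ t) : DeterminesMessage G t :=
  fun x y h => hs x y fun l hl => h l (hst hl)

theorem IsInformationSet.determinesMessage {n k : ℕ} {G : Matrix (Fin k) (Fin n) F}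
    {I : Finset (Fin n)} (hI : IsInformationSet G I) : DeterminesMessage G (I : Set (Fin n)) := by
  obtain ⟨hc, hu⟩ := hI
  intro x y h
  refine Matrix.vecMul_injective_of_isUnit hu (funext fun i => ?_)
  exact h (I.orderEmbOfFin hc i) (I.orderEmbOfFin_mem hc i)

theorem IsGeneratorMatrix.le {n k : ℕ} {G : Matrix (Fin k) (Fin n) F} (hG : IsGeneratorMatrix G) :
    k ≤ n := by
  have := LinearIndependent.fintype_card_le_finrank hG
  simpa using this

/-- A PIR achievable rate matrix as a family of permutations of its row indices: the entry `(i, l)`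
is set if and only if the `l`-th permutation maps `i` below `κ`. -/
theorem IsMDSPIRCapacityAchieving.exists_labelling {n k : ℕ} {G : Matrix (Fin k) (Fin n) F}
    (h : IsMDSPIRCapacityAchieving G) (hn : 0 < n) :
    ∃ ν κ : ℕ, 0 < ν ∧ κ ≤ ν ∧ κ * n = k * ν ∧
      ∃ θ : Fin n → Equiv.Perm (Fin ν), ∀ i, DeterminesMessage G {l | (θ l i : ℕ) < κ} := by
  classical
  obtain ⟨κ, ν, hν, hr, Λ, hcol, hrow⟩ := h
  have hκ : κ ≤ ν := by
    rw [← hcol ⟨0, hn⟩]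
    exact (Finset.card_le_univ _).trans_eq (Fintype.card_fin ν)
  have hcard : ∀ l, Fintype.card {i // Λ i l = true} =
      Fintype.card {i : Fin ν // (i : ℕ) < κ} := by
    intro l
    rw [Fintype.card_subtype, hcol, Fintype.card_subtype, Fin.card_filter_val_lt, min_eq_right hκ]
  -- The support of each column and the set of dummies both have `κ` elements; a bijection between
  -- them extends to a permutation.
  let e l := Fintype.equivOfCardEq (hcard l)
  refine ⟨ν, κ, hν, hκ, ?_, fun l => (e l).extendSubtype, fun i => ?_⟩
  · rw [div_eq_div_iff (by positivity) (by positivity)] at hr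
    exact_mod_cast hr
  · obtain ⟨I, hI, hΛ⟩ := hrow i
    exact hI.determinesMessage.mono fun l hl => (e l).extendSubtype_mem i (hΛ l hl)

/-- A linear Hamming isometry is monomial. -/
theorem exists_monomial_of_isometry [DecidableEq F] {a b : Type*} [Fintype a] [Fintype b]
    (φ : (a → F) ≃ₗ[F] (b → F)) (hφ : ∀ x y, hammingDist (φ x) (φ y) = hammingDist x y) :
    ∃ (σ : a ≃ b) (c : a → F), (∀ i, c i ≠ 0) ∧ ∀ x i, φ x (σ i) = c i * x i := by
  classical
  have hsingle : ∀ i, ∃ j t, t ≠ 0 ∧ φ (Pi.single i 1) = Pi.single j t := by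
    intro i
    have h1 : hammingNorm (φ (Pi.single i 1)) = 1 := by
      rw [← hammingDist_zero_right, ← map_zero φ, hφ, hammingDist_zero_right, hammingNorm,
        Finset.card_eq_one]
      exact ⟨i, by ext j; simp [Pi.single_apply]⟩
    obtain ⟨j, hj⟩ := Finset.card_eq_one.1 h1
    have hj' : ∀ j', φ (Pi.single i 1) j' ≠ 0 ↔ j' = j := fun j' => by
      simpa using Finset.ext_iff.1 hj j'
    refine ⟨j, φ (Pi.single i 1) j, (hj' j).2 rfl, funext fun j' => ?_⟩
    by_cases h : j' = j
    · subst h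
      simp
    · rw [Pi.single_eq_of_ne h]
      by_contra hne
      exact h ((hj' j').1 hne)
  choose s c hc hs using hsingle
  have hsmul : ∀ i t, φ (Pi.single i t) = Pi.single (s i) (t * c i) := by
    intro i t
    have : (Pi.single i t : a → F) = t • Pi.single i 1 := by
      rw [← Pi.single_smul, smul_eq_mul, mul_one]
    rw [this, map_smul, hs, ← Pi.single_smul, smul_eq_mul]
  have hinj : Function.Injective s := by
    intro i i' h
    -- If two unit vectors had proportional images, these multiples of them would have the same
    -- image.
    have h1 : φ (Pi.single i (c i')) = φ (Pi.single i' (c i)) := by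
      rw [hsmul, hsmul, h, mul_comm]
    by_contra hne
    have h2 := congrFun (φ.injective h1) i
    rw [Pi.single_eq_same, Pi.single_eq_of_ne hne] at h2
    exact hc i' h2
  have hcard : Fintype.card a = Fintype.card b := by
    simpa using φ.finrank_eq
  have hbij : Function.Bijective s := (Fintype.bijective_iff_injective_and_card s).2 ⟨hinj, hcard⟩
  refine ⟨Equiv.ofBijective s hbij, c, hc, fun x i => ?_⟩
  rw [← Finset.univ_sum_single x, map_sum, Finset.sum_apply, Finset.univ_sum_single,
    Fintype.sum_eq_single i]
  · rw [hsmul, Equiv.ofBijective_apply, Pi.single_eq_same, mul_comm]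
  · intro i' hi'
    rw [hsmul, Equiv.ofBijective_apply, Pi.single_eq_of_ne (hinj.ne hi'.symm)]

end Codes

/-! ### Rates of the schemes for a single code -/

section Counting

theorem card_fun_apply_mem {f ν : ℕ} (p : Fin ν → Prop) [DecidablePred p] (j : Fin f) :
    Fintype.card {u : Fin f → Fin ν // p (u j)} = Fintype.card {x // p x} * ν ^ (f - 1) := by
  rw [Fintype.card_congr (((Equiv.funSplitAt j (Fin ν)).subtypeEquiv
    (q := fun z => p z.1 ∧ True) (by simp [Equiv.funSplitAt, Equiv.piSplitAt])).trans
    (Equiv.subtypeProdEquivProd (q := fun _ => True))), Fintype.card_prod, Fintype.card_subtype_true]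
  simp

theorem card_prod_fun_exists_not {f ν : ℕ} (p : Fin ν → Prop) [DecidablePred p] :
    Fintype.card {s : {c // p c} × (Fin f → Fin ν) // ∃ j, ¬p (s.2 j)} =
      Fintype.card {c // p c} * (ν ^ f - Fintype.card {c // p c} ^ f) := by
  have h : Fintype.card {s : {c // p c} × (Fin f → Fin ν) // ∀ j, p (s.2 j)} =
      Fintype.card {c // p c} * Fintype.card {c // p c} ^ f := by
    rw [Fintype.card_congr ((Equiv.subtypeEquivRight (q := fun s : {c // p c} × (Fin f → Fin ν) =>
      True ∧ ∀ j, p (s.2 j)) (by simp)).trans ((Equiv.subtypeProdEquivProd (p := fun _ => True)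
      (q := fun u : Fin f → Fin ν => ∀ j, p (u j))).trans (Equiv.prodCongr (Equiv.refl _)
      (Equiv.subtypePiEquivPi (p := fun _ => p))))), Fintype.card_prod, Fintype.card_subtype_true]
    simp
  have h2 := Fintype.card_subtype_compl
    (fun s : {c // p c} × (Fin f → Fin ν) => ∀ j, p (s.2 j))
  rw [h] at h2
  simp only [not_forall] at h2
  rw [h2, Nat.mul_sub]
  simp

theorem card_fin_val_lt {ν κ : ℕ} (h : κ ≤ ν) : Fintype.card {x : Fin ν // (x : ℕ) < κ} = κ := by
  rw [Fintype.card_subtype, Fin.card_filter_val_lt, min_eq_right h]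

theorem card_fin_not_val_lt {ν κ : ℕ} (h : κ ≤ ν) :
    Fintype.card {x : Fin ν // ¬(x : ℕ) < κ} = ν - κ := by
  rw [Fintype.card_subtype_compl, card_fin_val_lt h, Fintype.card_fin]

end Counting

section SingleCode

variable {F : Type u} [Field F] {n k : ℕ} {G : Matrix (Fin k) (Fin n) F}

/-- For `k < n`, `sumScheme` has `β = (ν - κ) ν ^ f` stripes and returns `κ (ν ^ f - κ ^ f)` symbols
per node; `κ / ν = k / n` turns this into the capacity. The rate is expressed by the total download
because downloads add up over components. -/
theorem IsMDSPIRCapacityAchieving.exists_scheme (h : IsMDSPIRCapacityAchieving G)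
    (hG : IsGeneratorMatrix G) (hk : 0 < k) {f : ℕ} (hf : 0 < f) :
    ∃ (β : ℕ) (d : Fin n → ℕ), 0 < β ∧
      Nonempty (RetrievalScheme.{0} G (Fin f) (Fin β) fun l => Fin (d l)) ∧
      ((∑ l, d l : ℕ) : ℝ) = β * k * (mdsPIRCapacity n k f)⁻¹ := by
  have hn : 0 < n := hk.trans_le hG.le
  obtain ⟨ν, κ, hν, hκ, hr, θ, hθ⟩ := h.exists_labelling hn
  rcases hG.le.eq_or_lt with hkn | hkn
  -- For `k = n` the `n` nodes return `f` symbols each for a file of `k = n` symbols.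
  · refine ⟨1, fun _ => f, one_pos, ⟨(RetrievalScheme.full
      ((hθ ⟨0, hν⟩).mono (Set.subset_univ _))).reindex (Equiv.ofUnique _ _)
      fun _ => Equiv.refl _⟩, ?_⟩
    simp [mdsPIRCapacity, hkn]
  · have hκν : κ < ν := by
      by_contra hle
      have : κ = ν := le_antisymm hκ (not_lt.1 hle)
      subst this
      rw [mul_comm] at hr
      exact hkn.ne' (Nat.eq_of_mul_eq_mul_right hν hr)
    have hR : ∀ j : Fin f, Fintype.card (Fin ν × {u : Fin f → Fin ν // ¬(u j : ℕ) < κ}) =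
        Fintype.card (Fin ((ν - κ) * ν ^ f)) := by
      intro j
      rw [Fintype.card_prod, card_fun_apply_mem (fun x : Fin ν => ¬(x : ℕ) < κ),
        card_fin_not_val_lt hκ, Fintype.card_fin, Fintype.card_fin, mul_left_comm,
        mul_pow_sub_one hf.ne']
    refine ⟨(ν - κ) * ν ^ f, fun _ => κ * (ν ^ f - κ ^ f),
      Nat.mul_pos (Nat.sub_pos_of_lt hκν) (pow_pos hν f),
      ⟨(RetrievalScheme.sumScheme (dummy := fun x : Fin ν => (x : ℕ) < κ) θ hθ (R := Fin ((ν - κ) * ν ^ f))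
        fun j => ⟨Fintype.equivOfCardEq (hR j)⟩).reindex (Equiv.refl _) fun _ =>
          Fintype.equivOfCardEq ?_⟩, ?_⟩
    · rw [card_prod_fun_exists_not, card_fin_val_lt hκ, Fintype.card_fin]
    · have hnR : (0 : ℝ) < n := by exact_mod_cast hn
      have hνR : (0 : ℝ) < ν := by exact_mod_cast hν
      have hrR : (κ : ℝ) * n = k * ν := by exact_mod_cast hr
      have hsub : (n : ℝ) - k ≠ 0 := sub_ne_zero.2 (by exact_mod_cast hkn.ne')
      have hκk : (k : ℝ) / n = κ / ν := by
        rw [div_eq_div_iff hnR.ne' hνR.ne', hrR]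
      rw [mdsPIRCapacity, if_neg hkn.ne, hκk, div_pow, Finset.sum_const, Finset.card_univ,
        Fintype.card_fin, smul_eq_mul]
      push_cast [Nat.cast_sub hκ, Nat.cast_sub (Nat.pow_le_pow_left hκ f)]
      rw [mul_inv, inv_inv, inv_div, one_sub_div (pow_pos hνR f).ne']
      field_simp
      linear_combination ((ν : ℝ) ^ f - κ ^ f) * hrR

/-- In `starScheme` there are `(ν - κ) ν` stripes and `κ ν` symbols per node, both chosen before
`f`. -/
theorem IsMDSPIRCapacityAchieving.exists_star_scheme [Fintype F]
    (h : IsMDSPIRCapacityAchieving G) (hkn : k < n) :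
    ∃ (β : ℕ) (d : Fin n → ℕ), 0 < β ∧
      (∀ f : ℕ, Nonempty (RetrievalScheme.{u} G (Fin f) (Fin β) fun l => Fin (d l))) ∧
      ((∑ l, d l : ℕ) : ℝ) = β * k * (mdsPIRCapacityInf n k)⁻¹ := by
  classical
  have hn : 0 < n := (Nat.zero_le k).trans_lt hkn
  obtain ⟨ν, κ, hν, hκ, hr, θ, hθ⟩ := h.exists_labelling hn
  have hκν : κ < ν := by
    by_contra hle
    have : κ = ν := le_antisymm hκ (not_lt.1 hle)
    subst this
    rw [mul_comm] at hr
    exact hkn.ne' (Nat.eq_of_mul_eq_mul_right hν hr)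
  refine ⟨(ν - κ) * ν, fun _ => κ * ν, Nat.mul_pos (Nat.sub_pos_of_lt hκν) hν, fun f =>
    ⟨(RetrievalScheme.starScheme (dummy := fun x : Fin ν => (x : ℕ) < κ) θ hθ).reindex (Fintype.equivOfCardEq ?_) fun _ =>
      Fintype.equivOfCardEq ?_⟩, ?_⟩
  · rw [Fintype.card_prod, card_fin_not_val_lt hκ, Fintype.card_fin, Fintype.card_fin]
  · rw [Fintype.card_prod, card_fin_val_lt hκ, Fintype.card_fin, Fintype.card_fin]
  · have hnR : (0 : ℝ) < n := by exact_mod_cast hn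
    have hrR : (κ : ℝ) * n = k * ν := by exact_mod_cast hr
    have hsub : (n : ℝ) - k ≠ 0 := sub_ne_zero.2 (by exact_mod_cast hkn.ne')
    rw [mdsPIRCapacityInf, Finset.sum_const, Finset.card_univ, Fintype.card_fin, smul_eq_mul]
    push_cast [Nat.cast_sub hκ]
    rw [inv_div]
    field_simp
    linear_combination hrR

end SingleCode

/-! ### Direct sums -/

section DirectSum

universe v

variable {F : Type u} [Field F] [Fintype F] [DecidableEq F] {n k P : ℕ}
  {G : Matrix (Fin k) (Fin n) F} {np kp : Fin P → ℕ} {Gp : ∀ p, Matrix (Fin (kp p)) (Fin (np p)) F}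

/-- The set `s` of file numbers serves both claims: a singleton for a fixed `f`, and all numbers for
file-independence, since `β` and `d` are uniform over `s`. -/
theorem exists_protocol_of_components (hG : IsGeneratorMatrix G)
    (hiso : AreIsometric (rowCode G) (rowCode (Matrix.blockDiagonal' Gp))) (s : Set ℕ)
    (c : Fin P → ℝ)
    (h : ∀ p, ∃ (β : ℕ) (d : Fin (np p) → ℕ), 0 < β ∧
      (∀ f ∈ s, Nonempty (RetrievalScheme.{v} (Gp p) (Fin f) (Fin β) fun l => Fin (d l))) ∧
      ((∑ l, d l : ℕ) : ℝ) = β * kp p * (c p)⁻¹) :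
    ∃ (β : ℕ) (d : Fin n → ℕ), 0 < β ∧ pirRate k β d = (∑ p, (kp p : ℝ) / k * (c p)⁻¹)⁻¹ ∧
      ∀ f ∈ s, ∃ S : PIRProtocol F n f β d, S.IsPerfect G := by
  classical
  choose β d hβ hS hd using h
  obtain ⟨φ, hφ, hmap⟩ := hiso
  obtain ⟨σ, w, hw, hσ⟩ := exists_monomial_of_isometry φ hφ
  have hrow : ∀ r, ∃ a : (Σ p, Fin (kp p)) → F,
      ∑ i, a i • (Matrix.blockDiagonal' Gp).row i = φ (G.row r) := by
    intro r
    rw [← Submodule.mem_span_range_iff_exists_fun]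
    change φ (G.row r) ∈ rowCode (Matrix.blockDiagonal' Gp)
    rw [← hmap]
    exact Submodule.mem_map_of_mem (Submodule.subset_span (Set.mem_range_self r))
  choose A hA using hrow
  have hA' : ∀ r l, w l * G r l = (Matrix.of A * Matrix.blockDiagonal' Gp) r (σ l) := by
    intro r l
    have := congrFun (hA r) (σ l)
    rw [hσ] at this
    rw [Matrix.mul_apply]
    simpa using this.symm
  -- Component `p` is copied as often as the product of the other stripe numbers, so that all
  -- components have `∏ q, β q` stripes.
  let M : Fin P → ℕ := fun p => ∏ q ∈ Finset.univ.erase p, β q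
  have hM : ∀ p, M p * β p = ∏ q, β q := fun p =>
    Finset.prod_erase_mul _ _ (Finset.mem_univ p)
  have hpos : 0 < ∏ q, β q := Finset.prod_pos fun q _ => hβ q
  refine ⟨∏ q, β q, fun l => M (σ l).1 * d (σ l).1 (σ l).2, hpos, ?_, fun f hf => ?_⟩
  · have hsum : ((∑ l, M (σ l).1 * d (σ l).1 (σ l).2 : ℕ) : ℝ) =
        (∏ q, β q : ℕ) * ∑ p, (kp p : ℝ) * (c p)⁻¹ := by
      rw [σ.sum_comp fun z => M z.1 * d z.1 z.2, Fintype.sum_sigma, Finset.mul_sum, Nat.cast_sum]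
      refine Finset.sum_congr rfl fun p _ => ?_
      dsimp only
      rw [← Finset.mul_sum, Nat.cast_mul, hd, ← hM p, Nat.cast_mul]
      ring
    have hdiv : ∑ p, (kp p : ℝ) / k * (c p)⁻¹ = (∑ p, (kp p : ℝ) * (c p)⁻¹) / k := by
      rw [Finset.sum_div]
      exact Finset.sum_congr rfl fun p _ => div_mul_eq_mul_div _ _ _
    rw [pirRate, hsum, hdiv, inv_div, Nat.cast_mul,
      mul_div_mul_left _ _ (Nat.cast_ne_zero.2 hpos.ne')]
  · let S := RetrievalScheme.directSum fun p => ((hS p f hf).some.copies (Fin (M p))).reindex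
      (finProdFinEquiv.trans (finCongr (hM p))) fun l => finProdFinEquiv
    let S' := S.ofMonomial σ w hw (Matrix.of A) hA' fun X X' hX => funext fun r =>
      Matrix.vecMul_injective_iff.2 hG <| by
        simpa only [Matrix.mul_apply_eq_vecMul] using congrFun hX r
    exact ⟨S'.toProtocol, S'.toProtocol_isPerfect⟩

end DirectSum

/-! ### Limits of the rates and the main theorem -/

theorem tendsto_mdsPIRCapacity {n k : ℕ} (h : k < n) :
    Tendsto (fun f => mdsPIRCapacity n k f) atTop (𝓝 (mdsPIRCapacityInf n k)) := by
  have hn : (0 : ℝ) < n := by exact_mod_cast (Nat.zero_le k).trans_lt h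
  have hpow : Tendsto (fun f : ℕ => ((k : ℝ) / n) ^ f) atTop (𝓝 0) :=
    tendsto_pow_atTop_nhds_zero_of_lt_one (by positivity)
      ((div_lt_one hn).2 (by exact_mod_cast h))
  have := ((hpow.const_sub 1).inv₀ (by simp)).const_mul (((n : ℝ) - k) / n)
  simpa [mdsPIRCapacity, mdsPIRCapacityInf, h.ne] using this

theorem tendsto_directSumRate {k P : ℕ} (hP : 0 < P) {np kp : Fin P → ℕ} (hkp : ∀ p, 0 < kp p)
    (h : ∀ p, kp p < np p) :
    Tendsto (fun f => directSumRate k np kp f) atTop (𝓝 (directSumRateInf k np kp)) := by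
  -- For `k = 0` division by zero makes both rates `0`.
  rcases k.eq_zero_or_pos with rfl | hk
  · simp [directSumRate, directSumRateInf]
  · have hpos : ∀ p, 0 < mdsPIRCapacityInf (np p) (kp p) := fun p => by
      have h1 : (kp p : ℝ) < np p := by exact_mod_cast h p
      have h2 : (0 : ℝ) < np p := (Nat.cast_nonneg _).trans_lt h1
      exact div_pos (sub_pos.2 h1) h2
    have : Nonempty (Fin P) := ⟨⟨0, hP⟩⟩
    refine (tendsto_finsetSum _ fun p _ =>
      ((tendsto_mdsPIRCapacity (h p)).inv₀ (hpos p).ne').const_mul _).inv₀ (ne_of_gt ?_)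
    -- Inversion is continuous only away from `0`; the limit sum is positive since it is nonempty
    -- with positive terms.
    refine Finset.sum_pos (fun p _ => ?_) Finset.univ_nonempty
    have h1 : (0 : ℝ) < kp p := by exact_mod_cast hkp p
    have h2 := hpos p
    positivity

theorem theorem5 {F : Type u} [Field F] [Fintype F] [DecidableEq F] {n k P : ℕ}
    (G : Matrix (Fin k) (Fin n) F) (hG : IsGeneratorMatrix G)
    (hP : 0 < P) (np kp : Fin P → ℕ) (hkp : ∀ p, 0 < kp p)
    (Gp : ∀ p, Matrix (Fin (kp p)) (Fin (np p)) F)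
    (hGp : ∀ p, IsGeneratorMatrix (Gp p))
    (hcap : ∀ p, IsMDSPIRCapacityAchieving (Gp p))
    (hiso : AreIsometric (rowCode G) (rowCode (Matrix.blockDiagonal' Gp))) :
    (∀ f : ℕ, 0 < f → IsAchievableRate G f (directSumRate k np kp f)) ∧
    ((∀ p, kp p < np p) →
      Tendsto (fun f : ℕ => directSumRate k np kp f) atTop (𝓝 (directSumRateInf k np kp)) ∧
      IsFileIndependentAchievableRate G (directSumRateInf k np kp)) := by
  refine ⟨fun f hf => ?_, fun hlt => ⟨tendsto_directSumRate hP hkp hlt, ?_⟩⟩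
  · obtain ⟨β, d, hβ, hR, hS⟩ := exists_protocol_of_components hG hiso {f}
      (fun p => mdsPIRCapacity (np p) (kp p) f) fun p => by
        obtain ⟨β, d, hβ, hS, hd⟩ := (hcap p).exists_scheme (hGp p) (hkp p) hf
        exact ⟨β, d, hβ, by rintro _ rfl; exact hS, hd⟩
    exact ⟨β, d, hβ, hR, hS f rfl⟩
  · obtain ⟨β, d, hβ, hR, hS⟩ := exists_protocol_of_components hG hiso Set.univ
      (fun p => mdsPIRCapacityInf (np p) (kp p)) fun p => by
        obtain ⟨β, d, hβ, hS, hd⟩ := (hcap p).exists_star_scheme (hlt p)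
        exact ⟨β, d, hβ, fun f _ => hS f, hd⟩
    exact ⟨β, d, hβ, hR, fun f _ => hS f (Set.mem_univ f)⟩
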